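/- Let $Sg$ be a many-sorted first-order signature (types, typed function symbols, typed relation symbols). The \emph{Epsilon calculus} over $Sg$ has judgments in context $\Gamma\mid t=t':A$ and $\Gamma\mid\varphi_1,\dots,\varphi_n\vdash\psi$; its formulas are built from relation symbols by $\top,\bot,\wedge,\vee,\to,\neg,\exists,\forall$. Its rules are those of equational logic (reflexivity, symmetry, transitivity, substitution and congruence), the structural rules (including substitution), the introduction and elimination rules of classical many-sorted natural deduction with excluded middle, and the two rules: if $\Gamma,x:A\mid\psi$ is a formula then $\Gamma\mid\varepsilon_\psi:A$ is a term (in which $x$ is bound), and $\Gamma\mid\exists x{:}A.\,\psi\vdash\psi[\varepsilon_\psi/x]$. Substitution is capture-avoiding and goes inside epsilon terms. A \emph{boolean doctrine} $(\mathbb C,P)$ is a category $\mathbb C$ with finite products together with a functor $P:\mathbb C^{op}\to\mathbf{Boole}$ such that for every product projection $\pi:X\times Y\to X$ the homomorphism $P(\pi)$ has a left adjoint $\Sigma_\pi$ satisfying the Beck--Chevalley condition, i.e. $P(f)\,\Sigma_\pi=\Sigma_{\pi'}\,P(f\times \mathrm{id}_Y)$ for every $f:Z\to X$, where $\pi':Z\times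 Y\to Z$. An \emph{epsilon morphism} for $\psi\in P(X\times Y)$ is a morphism $e:X\to Y$ with $\Sigma_\pi\psi\le P(\langle \mathrm{id}_X,e\rangle)(\psi)$. The doctrine is an \emph{Epsilon doctrine} if every $\psi\in P(X\times Y)$, for all objects $X,Y$, has an epsilon morphism. \textbf{Proposition.} Let $(\mathbb C,P)$ be an Epsilon doctrine, and let there be given an object $\llbracket A\rrbracket$ of $\mathbb C$ for each type $A$, a morphism $\llbracket A_1\rrbracket\times\dots\times\llbracket A_n\rrbracket\to\llbracket B\rrbracket$ for each function symbol $A_1,\dots,A_n\to B$, and an element of $P(\llbracket A_1\rrbracket\times\dots\times\llbracket A_n\rrbracket)$ for each relation symbol on $A_1,\dots,A_n$. For a context $\Gamma=(x_1:A_1,\dots,x_n:A_n)$ put $\llbracket\Gamma\rrbracket=\llbracket A_1\rrbracket\times\dots\times\llbracket A_n\rrbracket$. Then this assignment extends to an interpretation of all terms $\Gamma\mid t:A$ of the Epsilon calculus as morphisms $\llbracket t\rrbracket:\llbracket\Gamma\rrbracket\to\llbracket A\rrbracket$ and of all formulas $\Gamma\mid\varphi$ as elements $\llbracket\varphi\rrbracket\in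 P(\llbracket\Gamma\rrbracket)$ such that: (1) variables are interpreted as projections, function symbols by composition with the tuple of the interpreted arguments, relation symbols by reindexing along that tuple, the propositional connectives by the boolean operations, $\exists x{:}A.\,\psi$ as $\Sigma_\pi\llbracket\psi\rrbracket$ and $\forall x{:}A.\,\psi$ as $\neg\Sigma_\pi\neg\llbracket\psi\rrbracket$ (the right adjoint of $P(\pi)$ applied to $\llbracket\psi\rrbracket$), for the projection $\pi:\llbracket\Gamma\rrbracket\times\llbracket A\rrbracket\to\llbracket\Gamma\rrbracket$; (2) for every formula $\Gamma,x:A\mid\psi$, the morphism $\llbracket\varepsilon_\psi\rrbracket:\llbracket\Gamma\rrbracket\to\llbracket A\rrbracket$ is an epsilon morphism for $\llbracket\psi\rrbracket\in P(\llbracket\Gamma\rrbracket\times\llbracket A\rrbracket)$; (3) substitution is interpreted by composition and reindexing: $\llbracket t[\vec s/\vec x]\rrbracket=\llbracket t\rrbracket\circ\langle\llbracket s_1\rrbracket,\dots,\llbracket s_n\rrbracket\rangle$ and $\llbracket\varphi[\vec s/\vec x]\rrbracket=P(\langle\llbracket s_1\rrbracket,\dots,\llbracket s_n\rrbracket\rangle)(\llbracket\varphi\rrbracket)$;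 (4) the interpretation is sound: if $\Gamma\mid\varphi_1,\dots,\varphi_n\vdash\psi$ is derivable then $\llbracket\varphi_1\rrbracket\wedge\dots\wedge\llbracket\varphi_n\rrbracket\le\llbracket\psi\rrbracket$, and if $\Gamma\mid t=t':A$ is derivable then $\llbracket t\rrbracket=\llbracket t'\rrbracket$; more generally this holds for derivability from any set of additional axioms (sequents and equations) that are valid in the interpretation. -/

import Mathlib

open CategoryTheory MonoidalCategory CartesianMonoidalCategory Opposite

universe u₁ u₂ u₃ v u w

namespace EpsilonCalculus

/-! ### The typed Epsilon calculus -/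

/-- A many-sorted first-order signature: types, function symbols `f : A₁, …, Aₙ → B` and
relation symbols `r ⊆ A₁, …, Aₙ`. -/
structure Signature : Type (max (u₁ + 1) (u₂ + 1) (u₃ + 1)) where
  Ty : Type u₁
  Fn : Type u₂
  fnDom : Fn → List Ty
  fnCod : Fn → Ty
  Rel : Type u₃
  relDom : Rel → List Ty

/-- Contexts, with the most recently declared variable first: `A :: Γ` is `Γ, x : A`. -/
abbrev Signature.Ctx (S : Signature.{u₁, u₂, u₃}) : Type u₁ := List S.Ty

/-- `Var Γ A`: the (typed de Bruijn) variables of type `A` declared in the context `Γ`. -/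
inductive Var {T : Type u₁} : List T → T → Type u₁
  | zero {Γ : List T} {A : T} : Var (A :: Γ) A
  | succ {Γ : List T} {A B : T} (x : Var Γ A) : Var (B :: Γ) A

mutual

/-- `Tm S Γ A`: the terms in context `Γ | t : A`, up to renaming of bound variables.
The arguments of a function symbol are a family of terms indexed by the finitely many positions of
its domain. `eps ψ` is the epsilon term `ε_ψ`, which binds the variable `x` of `Γ, x : A | ψ`. -/
inductive Tm (S : Signature.{u₁, u₂, u₃}) : S.Ctx → S.Ty → Type (max u₁ u₂ u₃)
  | var {Γ : S.Ctx} {A : S.Ty} (x : Var Γ A) : Tm S Γ A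
  | fn {Γ : S.Ctx} (f : S.Fn) (args : ∀ B : S.Ty, Var (S.fnDom f) B → Tm S Γ B) :
      Tm S Γ (S.fnCod f)
  | eps {Γ : S.Ctx} {A : S.Ty} (ψ : Fm S (A :: Γ)) : Tm S Γ A

/-- `Fm S Γ`: the formulas in context `Γ | φ`, up to renaming of bound variables. -/
inductive Fm (S : Signature.{u₁, u₂, u₃}) : S.Ctx → Type (max u₁ u₂ u₃)
  | rel {Γ : S.Ctx} (r : S.Rel) (args : ∀ B : S.Ty, Var (S.relDom r) B → Tm S Γ B) : Fm S Γ
  | top {Γ : S.Ctx} : Fm S Γ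
  | bot {Γ : S.Ctx} : Fm S Γ
  | and {Γ : S.Ctx} (φ ψ : Fm S Γ) : Fm S Γ
  | or {Γ : S.Ctx} (φ ψ : Fm S Γ) : Fm S Γ
  | imp {Γ : S.Ctx} (φ ψ : Fm S Γ) : Fm S Γ
  | neg {Γ : S.Ctx} (φ : Fm S Γ) : Fm S Γ
  | all {Γ : S.Ctx} {A : S.Ty} (ψ : Fm S (A :: Γ)) : Fm S Γ
  | ex {Γ : S.Ctx} {A : S.Ty} (ψ : Fm S (A :: Γ)) : Fm S Γ

end

variable {S : Signature.{u₁, u₂, u₃}}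

/-- Renamings of variables. -/
abbrev Ren (Γ Δ : S.Ctx) : Type u₁ := ∀ B : S.Ty, Var Γ B → Var Δ B

/-- A renaming extended by a fresh variable. -/
def Ren.lift {Γ Δ : S.Ctx} (ρ : Ren Γ Δ) (A : S.Ty) : Ren (S := S) (A :: Γ) (A :: Δ)
  | _, .zero => .zero
  | _, .succ x => .succ (ρ _ x)

mutual

/-- Renaming the free variables of a term. -/
def Tm.rename {Γ Δ : S.Ctx} {A : S.Ty} (ρ : Ren Γ Δ) : Tm S Γ A → Tm S Δ A
  | .var x => .var (ρ _ x)
  | .fn f args => .fn f (fun B x => (args B x).rename ρ)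
  | .eps ψ => .eps (ψ.rename (ρ.lift _))

/-- Renaming the free variables of a formula. -/
def Fm.rename {Γ Δ : S.Ctx} (ρ : Ren Γ Δ) : Fm S Γ → Fm S Δ
  | .rel r args => .rel r (fun B x => (args B x).rename ρ)
  | .top => .top
  | .bot => .bot
  | .and φ ψ => .and (φ.rename ρ) (ψ.rename ρ)
  | .or φ ψ => .or (φ.rename ρ) (ψ.rename ρ)
  | .imp φ ψ => .imp (φ.rename ρ) (ψ.rename ρ)
  | .neg φ => .neg (φ.rename ρ)
  | .all ψ => .all (ψ.rename (ρ.lift _))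
  | .ex ψ => .ex (ψ.rename (ρ.lift _))

end

/-- Weakening of a term by a fresh variable. -/
def Tm.weaken {Γ : S.Ctx} {A : S.Ty} (B : S.Ty) (t : Tm S Γ A) : Tm S (B :: Γ) A :=
  t.rename (fun _ x => .succ x)

/-- Weakening of a formula by a fresh variable. -/
def Fm.weaken {Γ : S.Ctx} (B : S.Ty) (φ : Fm S Γ) : Fm S (B :: Γ) :=
  φ.rename (fun _ x => .succ x)

/-- Simultaneous substitutions: a term `Δ | t : B` for each variable `x : B` of `Γ`. -/
abbrev Sub (S : Signature.{u₁, u₂, u₃}) (Γ Δ : S.Ctx) : Type (max u₁ u₂ u₃) :=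
  ∀ B : S.Ty, Var Γ B → Tm S Δ B

/-- A substitution extended by a fresh variable, which is sent to itself. -/
def Sub.lift {Γ Δ : S.Ctx} (σ : Sub S Γ Δ) (A : S.Ty) : Sub S (A :: Γ) (A :: Δ)
  | _, .zero => .var .zero
  | _, .succ x => (σ _ x).weaken A

/-- The substitution `[t/x]` for the last variable `x : A` of a context `Γ, x : A`. -/
def Sub.single {Γ : S.Ctx} {A : S.Ty} (t : Tm S Γ A) : Sub S (A :: Γ) Γ
  | _, .zero => t
  | _, .succ x => .var x

mutual

/-- Capture-avoiding simultaneous substitution in a term; it goes inside epsilon terms. -/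
def Tm.subst {Γ Δ : S.Ctx} {A : S.Ty} (σ : Sub S Γ Δ) : Tm S Γ A → Tm S Δ A
  | .var x => σ _ x
  | .fn f args => .fn f (fun B x => (args B x).subst σ)
  | .eps ψ => .eps (ψ.subst (σ.lift _))

/-- Capture-avoiding simultaneous substitution in a formula. -/
def Fm.subst {Γ Δ : S.Ctx} (σ : Sub S Γ Δ) : Fm S Γ → Fm S Δ
  | .rel r args => .rel r (fun B x => (args B x).subst σ)
  | .top => .top
  | .bot => .bot
  | .and φ ψ => .and (φ.subst σ) (ψ.subst σ)
  | .or φ ψ => .or (φ.subst σ) (ψ.subst σ)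
  | .imp φ ψ => .imp (φ.subst σ) (ψ.subst σ)
  | .neg φ => .neg (φ.subst σ)
  | .all ψ => .all (ψ.subst (σ.lift _))
  | .ex ψ => .ex (ψ.subst (σ.lift _))

end

/-- `ψ[t/x]` for `Γ, x : A | ψ` and `Γ | t : A`. -/
def Fm.inst {Γ : S.Ctx} {A : S.Ty} (ψ : Fm S (A :: Γ)) (t : Tm S Γ A) : Fm S Γ :=
  ψ.subst (Sub.single t)

/-- The two kinds of judgments: equations in context `Γ | t = t' : A` and sequents
`Γ | φ₁, …, φₙ ⊢ ψ`. -/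
inductive Judgment (S : Signature.{u₁, u₂, u₃}) : Type (max u₁ u₂ u₃)
  | eq {Γ : S.Ctx} {A : S.Ty} (t t' : Tm S Γ A) : Judgment S
  | seq {Γ : S.Ctx} (Φ : List (Fm S Γ)) (ψ : Fm S Γ) : Judgment S

open Judgment in
/-- Derivability in the Epsilon calculus over `S` extended by a set `T` of non-logical axioms
(`T = ∅` is the Epsilon calculus itself): equational logic, the structural rules, classical
many-sorted natural deduction, and the rule `Γ | ∃ x : A. ψ ⊢ ψ[ε_ψ/x]`. -/
inductive Derivable (T : Set (Judgment S)) : Judgment S → Prop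
  | of_mem {J : Judgment S} : J ∈ T → Derivable T J
  -- equational logic
  | eq_refl {Γ : S.Ctx} {A : S.Ty} (t : Tm S Γ A) : Derivable T (eq t t)
  | eq_symm {Γ : S.Ctx} {A : S.Ty} {t t' : Tm S Γ A} :
      Derivable T (eq t t') → Derivable T (eq t' t)
  | eq_trans {Γ : S.Ctx} {A : S.Ty} {t t' t'' : Tm S Γ A} :
      Derivable T (eq t t') → Derivable T (eq t' t'') → Derivable T (eq t t'')
  | eq_subst {Γ Δ : S.Ctx} {A : S.Ty} {t t' : Tm S Γ A} {σ σ' : Sub S Γ Δ} :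
      Derivable T (eq t t') → (∀ (B : S.Ty) (x : Var Γ B), Derivable T (eq (σ B x) (σ' B x))) →
      Derivable T (eq (t.subst σ) (t'.subst σ'))
  | eq_fm {Γ Δ : S.Ctx} (φ : Fm S Γ) {σ σ' : Sub S Γ Δ} :
      (∀ (B : S.Ty) (x : Var Γ B), Derivable T (eq (σ B x) (σ' B x))) →
      Derivable T (seq [φ.subst σ] (φ.subst σ'))
  -- structural rules
  | hyp {Γ : S.Ctx} {Φ : List (Fm S Γ)} {φ : Fm S Γ} : φ ∈ Φ → Derivable T (seq Φ φ)
  | weaken {Γ : S.Ctx} {Φ Ψ : List (Fm S Γ)} {φ : Fm S Γ} :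
      Φ ⊆ Ψ → Derivable T (seq Φ φ) → Derivable T (seq Ψ φ)
  | cut {Γ : S.Ctx} {Φ : List (Fm S Γ)} {φ ψ : Fm S Γ} :
      Derivable T (seq Φ φ) → Derivable T (seq (φ :: Φ) ψ) → Derivable T (seq Φ ψ)
  | seq_subst {Γ Δ : S.Ctx} {Φ : List (Fm S Γ)} {φ : Fm S Γ} (σ : Sub S Γ Δ) :
      Derivable T (seq Φ φ) → Derivable T (seq (Φ.map (Fm.subst σ)) (φ.subst σ))
  -- propositional rules
  | top_intro {Γ : S.Ctx} {Φ : List (Fm S Γ)} : Derivable T (seq Φ .top)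
  | bot_elim {Γ : S.Ctx} {Φ : List (Fm S Γ)} {φ : Fm S Γ} :
      Derivable T (seq Φ .bot) → Derivable T (seq Φ φ)
  | and_intro {Γ : S.Ctx} {Φ : List (Fm S Γ)} {φ ψ : Fm S Γ} :
      Derivable T (seq Φ φ) → Derivable T (seq Φ ψ) → Derivable T (seq Φ (.and φ ψ))
  | and_left {Γ : S.Ctx} {Φ : List (Fm S Γ)} {φ ψ : Fm S Γ} :
      Derivable T (seq Φ (.and φ ψ)) → Derivable T (seq Φ φ)
  | and_right {Γ : S.Ctx} {Φ : List (Fm S Γ)} {φ ψ : Fm S Γ} :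
      Derivable T (seq Φ (.and φ ψ)) → Derivable T (seq Φ ψ)
  | or_inl {Γ : S.Ctx} {Φ : List (Fm S Γ)} {φ ψ : Fm S Γ} :
      Derivable T (seq Φ φ) → Derivable T (seq Φ (.or φ ψ))
  | or_inr {Γ : S.Ctx} {Φ : List (Fm S Γ)} {φ ψ : Fm S Γ} :
      Derivable T (seq Φ ψ) → Derivable T (seq Φ (.or φ ψ))
  | or_elim {Γ : S.Ctx} {Φ : List (Fm S Γ)} {φ ψ χ : Fm S Γ} :
      Derivable T (seq Φ (.or φ ψ)) → Derivable T (seq (φ :: Φ) χ) →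
      Derivable T (seq (ψ :: Φ) χ) → Derivable T (seq Φ χ)
  | imp_intro {Γ : S.Ctx} {Φ : List (Fm S Γ)} {φ ψ : Fm S Γ} :
      Derivable T (seq (φ :: Φ) ψ) → Derivable T (seq Φ (.imp φ ψ))
  | imp_elim {Γ : S.Ctx} {Φ : List (Fm S Γ)} {φ ψ : Fm S Γ} :
      Derivable T (seq Φ (.imp φ ψ)) → Derivable T (seq Φ φ) → Derivable T (seq Φ ψ)
  | neg_intro {Γ : S.Ctx} {Φ : List (Fm S Γ)} {φ : Fm S Γ} :
      Derivable T (seq (φ :: Φ) .bot) → Derivable T (seq Φ (.neg φ))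
  | neg_elim {Γ : S.Ctx} {Φ : List (Fm S Γ)} {φ : Fm S Γ} :
      Derivable T (seq Φ (.neg φ)) → Derivable T (seq Φ φ) → Derivable T (seq Φ .bot)
  | em {Γ : S.Ctx} {Φ : List (Fm S Γ)} (φ : Fm S Γ) : Derivable T (seq Φ (.or φ (.neg φ)))
  -- quantifier rules
  | all_intro {Γ : S.Ctx} {A : S.Ty} {Φ : List (Fm S Γ)} {ψ : Fm S (A :: Γ)} :
      Derivable T (seq (Φ.map (Fm.weaken A)) ψ) → Derivable T (seq Φ (.all ψ))
  | all_elim {Γ : S.Ctx} {A : S.Ty} {Φ : List (Fm S Γ)} {ψ : Fm S (A :: Γ)} (t : Tm S Γ A) :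
      Derivable T (seq Φ (.all ψ)) → Derivable T (seq Φ (ψ.inst t))
  | ex_intro {Γ : S.Ctx} {A : S.Ty} {Φ : List (Fm S Γ)} {ψ : Fm S (A :: Γ)} (t : Tm S Γ A) :
      Derivable T (seq Φ (ψ.inst t)) → Derivable T (seq Φ (.ex ψ))
  | ex_elim {Γ : S.Ctx} {A : S.Ty} {Φ : List (Fm S Γ)} {ψ : Fm S (A :: Γ)} {χ : Fm S Γ} :
      Derivable T (seq Φ (.ex ψ)) →
      Derivable T (seq (ψ :: Φ.map (Fm.weaken A)) (χ.weaken A)) → Derivable T (seq Φ χ)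
  -- the rule for epsilon terms
  | eps_intro {Γ : S.Ctx} {A : S.Ty} (ψ : Fm S (A :: Γ)) :
      Derivable T (seq [.ex ψ] (ψ.inst (.eps ψ)))

/-! ### Doctrines -/

/-- A boolean doctrine on a category `C` with finite products: a functor `P : Cᵒᵖ ⥤ BoolAlg` such
that, for every projection `π : X × Y ⟶ X`, the homomorphism `P(π)` has a left adjoint `Σ_π`
satisfying the Beck-Chevalley condition. (The symmetry `X × Y ≅ Y × X` gives the same for the
other projection, and adjoints between posets are unique, so `sigma` is no additional choice.) -/
structure BooleanDoctrine (C : Type u) [Category.{v} C] [CartesianMonoidalCategory C] where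
  P : Cᵒᵖ ⥤ BoolAlg.{w}
  sigma : ∀ X Y : C, P.obj (op (X ⊗ Y)) → P.obj (op X)
  sigma_adj : ∀ X Y : C, GaloisConnection (sigma X Y) (P.map (fst X Y).op).hom
  beck_chevalley : ∀ (X Y Z : C) (f : Z ⟶ X) (ψ : P.obj (op (X ⊗ Y))),
    (P.map f.op).hom (sigma X Y ψ) = sigma Z Y ((P.map (f ▷ Y).op).hom ψ)

variable {C : Type u} [Category.{v} C] [CartesianMonoidalCategory C]

namespace BooleanDoctrine

/-- The boolean algebra `P(X)`. -/
abbrev Pred (D : BooleanDoctrine.{v, u, w} C) (X : C) : Type w := D.P.obj (op X)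

/-- The homomorphism `P(f) : P(Y) → P(X)` for `f : X ⟶ Y`. -/
abbrev reindex (D : BooleanDoctrine.{v, u, w} C) {X Y : C} (f : X ⟶ Y) (ψ : D.Pred Y) : D.Pred X :=
  (D.P.map f.op).hom ψ

/-- Universal quantification along `π : X × Y ⟶ X`, the right adjoint of `P(π)`. -/
def pi (D : BooleanDoctrine.{v, u, w} C) (X Y : C) (ψ : D.Pred (X ⊗ Y)) : D.Pred X :=
  (D.sigma X Y ψᶜ)ᶜ

theorem pi_adj (D : BooleanDoctrine.{v, u, w} C) (X Y : C) :
    GaloisConnection (D.reindex (fst X Y)) (D.pi X Y) := by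
  intro a ψ
  have h := D.sigma_adj X Y ψᶜ aᶜ
  rw [map_compl', compl_le_compl_iff_le] at h
  rw [pi, ← h, le_compl_comm]

/-- `e : X ⟶ Y` is an epsilon morphism for `ψ ∈ P(X × Y)`. -/
def IsEpsilonMorphism (D : BooleanDoctrine.{v, u, w} C) {X Y : C} (ψ : D.Pred (X ⊗ Y))
    (e : X ⟶ Y) : Prop :=
  D.sigma X Y ψ ≤ D.reindex (lift (𝟙 X) e) ψ

/-- An Epsilon doctrine: every `ψ ∈ P(X × Y)` has an epsilon morphism `X ⟶ Y`. -/
def IsEpsilonDoctrine (D : BooleanDoctrine.{v, u, w} C) : Prop :=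
  ∀ (X Y : C) (ψ : D.Pred (X ⊗ Y)), ∃ e : X ⟶ Y, D.IsEpsilonMorphism ψ e

end BooleanDoctrine

/-! ### Interpretations -/

/-- `⟦Γ⟧ = ⟦A₁⟧ × … × ⟦Aₙ⟧`, for an assignment `obj` of objects to types. -/
@[reducible] def ctxObj {T : Type u₁} (obj : T → C) : List T → C
  | [] => 𝟙_ C
  | A :: Γ => ctxObj obj Γ ⊗ obj A

/-- The projection `⟦Γ⟧ ⟶ ⟦A⟧` at a variable of `Γ`. -/
def varHom {T : Type u₁} (obj : T → C) : ∀ {Γ : List T} {A : T}, Var Γ A → (ctxObj obj Γ ⟶ obj A)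
  | B :: Γ, _, .zero => snd (ctxObj obj Γ) (obj B)
  | B :: Γ, _, .succ x => fst (ctxObj obj Γ) (obj B) ≫ varHom obj x

/-- The tuple `⟨g₁, …, gₙ⟩ : X ⟶ ⟦Γ⟧` of a family of morphisms `gᵢ : X ⟶ ⟦Aᵢ⟧`. -/
def tuple {T : Type u₁} (obj : T → C) {X : C} :
    ∀ Γ : List T, (∀ B : T, Var Γ B → (X ⟶ obj B)) → (X ⟶ ctxObj obj Γ)
  | [], _ => toUnit X
  | A :: Γ, g => lift (tuple obj Γ (fun B x => g B (.succ x))) (g A .zero)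

/-- An assignment of the symbols of a signature in a boolean doctrine. -/
structure Assignment (S : Signature.{u₁, u₂, u₃}) (D : BooleanDoctrine.{v, u, w} C) where
  obj : S.Ty → C
  fn : ∀ f : S.Fn, ctxObj obj (S.fnDom f) ⟶ obj (S.fnCod f)
  rel : ∀ r : S.Rel, D.Pred (ctxObj obj (S.relDom r))

/-- An interpretation of all terms and formulas of the Epsilon calculus that extends the
assignment `M`: variables are interpreted as projections, function and relation symbols by
composition and reindexing, the connectives by the boolean operations, the quantifiers by the
adjoints of reindexing along the projection `π : ⟦Γ⟧ × ⟦A⟧ ⟶ ⟦Γ⟧`, and every epsilon term `ε_ψ` as an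
epsilon morphism for `⟦ψ⟧`. -/
structure Interpretation {D : BooleanDoctrine.{v, u, w} C} (M : Assignment S D) where
  tm : ∀ {Γ : S.Ctx} {A : S.Ty}, Tm S Γ A → (ctxObj M.obj Γ ⟶ M.obj A)
  fm : ∀ {Γ : S.Ctx}, Fm S Γ → D.Pred (ctxObj M.obj Γ)
  tm_var : ∀ {Γ : S.Ctx} {A : S.Ty} (x : Var Γ A), tm (.var x) = varHom M.obj x
  tm_fn : ∀ {Γ : S.Ctx} (f : S.Fn) (args : ∀ B : S.Ty, Var (S.fnDom f) B → Tm S Γ B),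
    tm (.fn f args) = tuple M.obj _ (fun B x => tm (args B x)) ≫ M.fn f
  tm_eps : ∀ {Γ : S.Ctx} {A : S.Ty} (ψ : Fm S (A :: Γ)), D.IsEpsilonMorphism (fm ψ) (tm (.eps ψ))
  fm_rel : ∀ {Γ : S.Ctx} (r : S.Rel) (args : ∀ B : S.Ty, Var (S.relDom r) B → Tm S Γ B),
    fm (.rel r args) = D.reindex (tuple M.obj _ (fun B x => tm (args B x))) (M.rel r)
  fm_top : ∀ {Γ : S.Ctx}, fm (.top : Fm S Γ) = ⊤
  fm_bot : ∀ {Γ : S.Ctx}, fm (.bot : Fm S Γ) = ⊥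
  fm_and : ∀ {Γ : S.Ctx} (φ ψ : Fm S Γ), fm (.and φ ψ) = fm φ ⊓ fm ψ
  fm_or : ∀ {Γ : S.Ctx} (φ ψ : Fm S Γ), fm (.or φ ψ) = fm φ ⊔ fm ψ
  fm_imp : ∀ {Γ : S.Ctx} (φ ψ : Fm S Γ), fm (.imp φ ψ) = fm φ ⇨ fm ψ
  fm_neg : ∀ {Γ : S.Ctx} (φ : Fm S Γ), fm (.neg φ) = (fm φ)ᶜ
  fm_all : ∀ {Γ : S.Ctx} {A : S.Ty} (ψ : Fm S (A :: Γ)),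
    fm (.all ψ) = D.pi (ctxObj M.obj Γ) (M.obj A) (fm ψ)
  fm_ex : ∀ {Γ : S.Ctx} {A : S.Ty} (ψ : Fm S (A :: Γ)),
    fm (.ex ψ) = D.sigma (ctxObj M.obj Γ) (M.obj A) (fm ψ)

namespace Interpretation

variable {D : BooleanDoctrine.{v, u, w} C} {M : Assignment S D}

/-- The morphism `⟨⟦t₁⟧, …, ⟦tₙ⟧⟩ : ⟦Δ⟧ ⟶ ⟦Γ⟧` of a substitution of terms in context `Δ` for the
variables of `Γ`. -/
def sub (I : Interpretation M) {Γ Δ : S.Ctx} (σ : Sub S Γ Δ) : ctxObj M.obj Δ ⟶ ctxObj M.obj Γ :=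
  tuple M.obj Γ (fun B x => I.tm (σ B x))

/-- Validity of a judgment: `⟦t⟧ = ⟦t'⟧`, respectively `⟦φ₁⟧ ⊓ … ⊓ ⟦φₙ⟧ ≤ ⟦ψ⟧`. -/
def Valid (I : Interpretation M) : Judgment S → Prop
  | .eq t t' => I.tm t = I.tm t'
  | .seq Φ ψ => (Φ.map I.fm).foldr (· ⊓ ·) ⊤ ≤ I.fm ψ

end Interpretation

end EpsilonCalculus

namespace EpsilonCalculus

section

variable {S : Signature.{u₁, u₂, u₃}} {C : Type u} [Category.{v} C] [CartesianMonoidalCategory C]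
  {D : BooleanDoctrine.{v, u, w} C}

/-! ### Tuples and reindexing -/

theorem tuple_varHom {T : Type u₁} (obj : T → C) {X : C} :
    ∀ {Γ : List T} (g : ∀ B : T, Var Γ B → (X ⟶ obj B)) {A : T} (x : Var Γ A),
      tuple obj Γ g ≫ varHom obj x = g A x
  | _, g, _, .zero => by simp [tuple, varHom]
  | _, g, _, .succ x => by
      rw [tuple, varHom, lift_fst_assoc, tuple_varHom obj _ x]

theorem comp_tuple {T : Type u₁} (obj : T → C) {X Y : C} (f : Y ⟶ X) :
    ∀ {Γ : List T} (g : ∀ B : T, Var Γ B → (X ⟶ obj B)),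
      f ≫ tuple obj Γ g = tuple obj Γ (fun B x => f ≫ g B x)
  | [], _ => toUnit_unique _ _
  | A :: Γ, g => by rw [tuple, tuple, comp_lift, comp_tuple obj f]

theorem tuple_comp_varHom {T : Type u₁} (obj : T → C) {X : C} :
    ∀ {Γ : List T} (f : X ⟶ ctxObj obj Γ),
      tuple obj Γ (fun _ x => f ≫ varHom obj x) = f
  | [], _ => toUnit_unique _ _
  | A :: Γ, f => by
      have h := tuple_comp_varHom obj (f ≫ fst (ctxObj obj Γ) (obj A))
      simp only [Category.assoc] at h
      simp only [tuple, varHom, h]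
      ext <;> simp

namespace BooleanDoctrine

theorem reindex_comp (D : BooleanDoctrine.{v, u, w} C) {X Y Z : C} (f : X ⟶ Y) (g : Y ⟶ Z)
    (p : D.Pred Z) : D.reindex (f ≫ g) p = D.reindex f (D.reindex g p) := by
  simp [reindex]

theorem reindex_id (D : BooleanDoctrine.{v, u, w} C) {X : C} (p : D.Pred X) :
    D.reindex (𝟙 X) p = p := by
  simp [reindex]

theorem reindex_mono (D : BooleanDoctrine.{v, u, w} C) {X Y : C} (f : X ⟶ Y) {p q : D.Pred Y}
    (h : p ≤ q) : D.reindex f p ≤ D.reindex f q :=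
  OrderHomClass.mono (D.P.map f.op).hom h

theorem reindex_compl (D : BooleanDoctrine.{v, u, w} C) {X Y : C} (f : X ⟶ Y) (p : D.Pred Y) :
    D.reindex f pᶜ = (D.reindex f p)ᶜ :=
  map_compl' (D.P.map f.op).hom p

theorem reindex_sigma (D : BooleanDoctrine.{v, u, w} C) {X Y Z : C} (f : Z ⟶ X)
    (p : D.Pred (X ⊗ Y)) :
    D.reindex f (D.sigma X Y p) = D.sigma Z Y (D.reindex (f ▷ Y) p) :=
  D.beck_chevalley X Y Z f p

theorem reindex_pi (D : BooleanDoctrine.{v, u, w} C) {X Y Z : C} (f : Z ⟶ X)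
    (p : D.Pred (X ⊗ Y)) :
    D.reindex f (D.pi X Y p) = D.pi Z Y (D.reindex (f ▷ Y) p) := by
  rw [pi, pi, reindex_compl, reindex_sigma, reindex_compl]

theorem IsEpsilonMorphism.reindex {X Y Z : C} {p : D.Pred (X ⊗ Y)} {e : X ⟶ Y}
    (h : D.IsEpsilonMorphism p e) (f : Z ⟶ X) :
    D.IsEpsilonMorphism (D.reindex (f ▷ Y) p) (f ≫ e) := by
  have hf : lift (𝟙 Z) (f ≫ e) ≫ f ▷ Y = f ≫ lift (𝟙 X) e := by ext <;> simp
  rw [IsEpsilonMorphism, ← reindex_sigma, ← reindex_comp, hf, reindex_comp]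
  exact D.reindex_mono f h

end BooleanDoctrine

/-! ### Formal terms over the morphisms of a category -/

/-- Formal terms in context `Γ` whose sorts are the objects and whose function symbols are the
morphisms of `C`. The doctrine `D` serves to fix the universe, so that terms and formulas can be
translated by a mutual recursion. -/
inductive ETm (D : BooleanDoctrine.{v, u, w} C) {T : Type u₁} (obj : T → C) (Γ : List T) :
    C → Type (max u₁ u v w)
  | var {A : T} (x : Var Γ A) : ETm D obj Γ (obj A)
  | unit : ETm D obj Γ (𝟙_ C)
  | pair {X Y : C} (s : ETm D obj Γ X) (t : ETm D obj Γ Y) : ETm D obj Γ (X ⊗ Y)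
  | app {X Y : C} (m : X ⟶ Y) (t : ETm D obj Γ X) : ETm D obj Γ Y

namespace ETm

variable {T : Type u₁} {obj : T → C} {Γ Δ : List T}

/-- The value of a formal term. -/
def val {X : C} : ETm D obj Γ X → (ctxObj obj Γ ⟶ X)
  | .var x => varHom obj x
  | .unit => toUnit _
  | .pair s t => lift s.val t.val
  | .app m t => t.val ≫ m

/-- Substitution in a formal term. -/
def subst (σ : ∀ B : T, Var Γ B → ETm D obj Δ (obj B)) {X : C} : ETm D obj Γ X → ETm D obj Δ X
  | .var x => σ _ x
  | .unit => .unit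
  | .pair s t => .pair (s.subst σ) (t.subst σ)
  | .app m t => .app m (t.subst σ)

theorem val_subst (σ : ∀ B : T, Var Γ B → ETm D obj Δ (obj B)) {X : C} (t : ETm D obj Γ X) :
    (t.subst σ).val = tuple obj Γ (fun B x => (σ B x).val) ≫ t.val := by
  induction t with
  | var x => exact (tuple_varHom obj (fun B x => (σ B x).val) x).symm
  | unit => exact toUnit_unique _ _
  | pair s t hs ht => simp only [subst, val, comp_lift, hs, ht]
  | app m t ht => simp only [subst, val, ht, Category.assoc]

/-- Tupling of formal terms. -/
def tuple : ∀ Θ : List T, (∀ B : T, Var Θ B → ETm D obj Γ (obj B)) → ETm D obj Γ (ctxObj obj Θ)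
  | [], _ => .unit
  | A :: Θ, g => .pair (tuple Θ (fun B x => g B (.succ x))) (g A .zero)

theorem val_tuple : ∀ (Θ : List T) (g : ∀ B : T, Var Θ B → ETm D obj Γ (obj B)),
    (tuple Θ g).val = EpsilonCalculus.tuple obj Θ (fun B x => (g B x).val)
  | [], _ => rfl
  | A :: Θ, g => by rw [tuple, val, val_tuple Θ, EpsilonCalculus.tuple]

theorem subst_tuple (σ : ∀ B : T, Var Γ B → ETm D obj Δ (obj B)) :
    ∀ (Θ : List T) (g : ∀ B : T, Var Θ B → ETm D obj Γ (obj B)),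
      (tuple Θ g).subst σ = tuple Θ (fun B x => (g B x).subst σ)
  | [], _ => rfl
  | A :: Θ, g => by rw [tuple, subst, subst_tuple σ Θ, tuple]

end ETm

/-- A morphism into `X` with a parameter in `Z`, whose other arguments are given by a formal
term. -/
structure Abstraction (D : BooleanDoctrine.{v, u, w} C) {T : Type u₁} (obj : T → C) (Γ : List T)
    (Z X : C) where
  dom : C
  hom : dom ⊗ Z ⟶ X
  arg : ETm D obj Γ dom

namespace Abstraction

variable {T : Type u₁} {obj : T → C} {Γ Δ : List T} {Z : C}

/-- Substitution in the arguments of an abstraction. -/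
def subst (σ : ∀ B : T, Var Γ B → ETm D obj Δ (obj B)) {X : C} (a : Abstraction D obj Γ Z X) :
    Abstraction D obj Δ Z X :=
  ⟨a.dom, a.hom, a.arg.subst σ⟩

/-- The value of an abstraction. -/
def val {X : C} (a : Abstraction D obj Γ Z X) : ctxObj obj Γ ⊗ Z ⟶ X :=
  a.arg.val ▷ Z ≫ a.hom

/-- Either a term that does not depend on the parameter, or a proper abstraction; in both cases
seen as an abstraction. -/
def ofSum {X : C} : ETm D obj Γ X ⊕ Abstraction D obj Γ Z X → Abstraction D obj Γ Z X
  | .inl t => ⟨X, fst X Z, t⟩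
  | .inr a => a

/-- Pairing of two abstractions. -/
def pair {X Y : C} (a : Abstraction D obj Γ Z X) (b : Abstraction D obj Γ Z Y) :
    Abstraction D obj Γ Z (X ⊗ Y) :=
  ⟨a.dom ⊗ b.dom, lift (fst a.dom b.dom ▷ Z ≫ a.hom) (snd a.dom b.dom ▷ Z ≫ b.hom),
    .pair a.arg b.arg⟩

theorem val_pair {X Y : C} (a : Abstraction D obj Γ Z X) (b : Abstraction D obj Γ Z Y) :
    (a.pair b).val = lift a.val b.val := by
  simp only [val, pair, ETm.val, comp_lift, ← comp_whiskerRight_assoc, lift_fst, lift_snd]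

/-- Substitution in a term or an abstraction. -/
def substSum (σ : ∀ B : T, Var Γ B → ETm D obj Δ (obj B)) {X : C} :
    ETm D obj Γ X ⊕ Abstraction D obj Γ Z X → ETm D obj Δ X ⊕ Abstraction D obj Δ Z X :=
  Sum.map (ETm.subst σ) (subst σ)

/-- Pairing of terms or abstractions; the result is an abstraction if one of them is. -/
def pairSum {X Y : C} : ETm D obj Γ X ⊕ Abstraction D obj Γ Z X →
    ETm D obj Γ Y ⊕ Abstraction D obj Γ Z Y → ETm D obj Γ (X ⊗ Y) ⊕ Abstraction D obj Γ Z (X ⊗ Y)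
  | .inl s, .inl t => .inl (.pair s t)
  | .inl s, .inr b => .inr ((ofSum (.inl s)).pair b)
  | .inr a, .inl t => .inr (a.pair (ofSum (.inl t)))
  | .inr a, .inr b => .inr (a.pair b)

/-- Postcomposition of a term or an abstraction with a morphism. -/
def appSum {X Y : C} (m : X ⟶ Y) : ETm D obj Γ X ⊕ Abstraction D obj Γ Z X →
    ETm D obj Γ Y ⊕ Abstraction D obj Γ Z Y
  | .inl t => .inl (.app m t)
  | .inr a => .inr ⟨a.dom, a.hom ≫ m, a.arg⟩

theorem ofSum_substSum (σ : ∀ B : T, Var Γ B → ETm D obj Δ (obj B)) {X : C}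
    (a : ETm D obj Γ X ⊕ Abstraction D obj Γ Z X) :
    ofSum (substSum σ a) = (ofSum a).subst σ := by
  cases a <;> rfl

theorem pairSum_substSum (σ : ∀ B : T, Var Γ B → ETm D obj Δ (obj B)) {X Y : C}
    (a : ETm D obj Γ X ⊕ Abstraction D obj Γ Z X) (b : ETm D obj Γ Y ⊕ Abstraction D obj Γ Z Y) :
    pairSum (substSum σ a) (substSum σ b) = substSum σ (pairSum a b) := by
  cases a <;> cases b <;> rfl

theorem appSum_substSum (σ : ∀ B : T, Var Γ B → ETm D obj Δ (obj B)) {X Y : C} (m : X ⟶ Y)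
    (a : ETm D obj Γ X ⊕ Abstraction D obj Γ Z X) :
    appSum m (substSum σ a) = substSum σ (appSum m a) := by
  cases a <;> rfl

theorem val_ofSum_pairSum {X Y : C}
    (a : ETm D obj Γ X ⊕ Abstraction D obj Γ Z X) (b : ETm D obj Γ Y ⊕ Abstraction D obj Γ Z Y) :
    (ofSum (pairSum a b)).val = lift (ofSum a).val (ofSum b).val := by
  cases a <;> cases b
  case inl.inl s t => simp [pairSum, ofSum, val, ETm.val]
  all_goals exact val_pair _ _

theorem val_ofSum_appSum {X Y : C} (m : X ⟶ Y)
    (a : ETm D obj Γ X ⊕ Abstraction D obj Γ Z X) :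
    (ofSum (appSum m a)).val = (ofSum a).val ≫ m := by
  cases a <;> simp [appSum, ofSum, val, ETm.val]

end Abstraction

namespace ETm

open Abstraction

variable {T : Type u₁} {obj : T → C} {Γ Δ : List T} {A : T}

/-- Abstraction of a variable. -/
def absVar (obj : T → C) {A B : T} : Var (A :: Γ) B →
    ETm D obj Γ (obj B) ⊕ Abstraction D obj Γ (obj A) (obj B)
  | .zero => .inr ⟨𝟙_ C, snd _ _, .unit⟩
  | .succ x => .inl (.var x)

/-- Abstraction of the last variable in a formal term: the maximal subterms in which the variable
does not occur become the arguments. -/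
def abs {X : C} : ETm D obj (A :: Γ) X → ETm D obj Γ X ⊕ Abstraction D obj Γ (obj A) X
  | .var x => absVar obj x
  | .unit => .inl .unit
  | .pair s t => pairSum s.abs t.abs
  | .app m t => appSum m t.abs

theorem val_abs {X : C} (t : ETm D obj (A :: Γ) X) : (ofSum t.abs).val = t.val := by
  induction t with
  | var x =>
    cases x with
    | zero => exact whiskerRight_snd _ _
    | succ x => exact whiskerRight_fst _ _
  | unit => exact toUnit_unique _ _
  | pair s t hs ht => rw [abs, val_ofSum_pairSum, hs, ht, val]
  | app m t ht => rw [abs, val_ofSum_appSum, ht, val]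

theorem abs_weaken {X : C} (t : ETm D obj Γ X) :
    (t.subst (fun _ x => .var (.succ x)) : ETm D obj (A :: Γ) X).abs = .inl t := by
  induction t with
  | var x => rfl
  | unit => rfl
  | pair s t hs ht => rw [subst, abs, hs, ht, pairSum]
  | app m t ht => rw [subst, abs, ht, appSum]

/-- A substitution of formal terms extended by a fresh variable. -/
def liftSub (σ : ∀ B : T, Var Γ B → ETm D obj Δ (obj B)) (A : T) :
    ∀ B : T, Var (A :: Γ) B → ETm D obj (A :: Δ) (obj B)
  | _, .zero => .var .zero
  | _, .succ x => (σ _ x).subst (fun _ y => .var (.succ y))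

theorem abs_subst (σ : ∀ B : T, Var Γ B → ETm D obj Δ (obj B)) {X : C} (t : ETm D obj (A :: Γ) X) :
    (t.subst (liftSub σ A)).abs = substSum σ t.abs := by
  induction t with
  | var x =>
    cases x with
    | zero => rfl
    | succ x => exact abs_weaken _
  | unit => rfl
  | pair s t hs ht => rw [subst, abs, hs, ht, pairSum_substSum, abs]
  | app m t ht => rw [subst, abs, ht, appSum_substSum, abs]

end ETm

/-- Formal formulas: a predicate applied to a formal term. -/
structure EFm (D : BooleanDoctrine.{v, u, w} C) {T : Type u₁} (obj : T → C) (Γ : List T) where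
  dom : C
  pred : D.Pred dom
  arg : ETm D obj Γ dom

namespace EFm

variable {T : Type u₁} {obj : T → C} {Γ Δ : List T} {A : T}

/-- The value of a formal formula. -/
def val (φ : EFm D obj Γ) : D.Pred (ctxObj obj Γ) := D.reindex φ.arg.val φ.pred

/-- Substitution in a formal formula. -/
def subst (σ : ∀ B : T, Var Γ B → ETm D obj Δ (obj B)) (φ : EFm D obj Γ) : EFm D obj Δ :=
  ⟨φ.dom, φ.pred, φ.arg.subst σ⟩

theorem val_subst (σ : ∀ B : T, Var Γ B → ETm D obj Δ (obj B)) (φ : EFm D obj Γ) :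
    (φ.subst σ).val = D.reindex (tuple obj Γ (fun B x => (σ B x).val)) φ.val := by
  rw [val, subst, ETm.val_subst, BooleanDoctrine.reindex_comp, val]

/-- A constant formal formula. -/
def const (p : D.Pred (𝟙_ C)) : EFm D obj Γ := ⟨𝟙_ C, p, .unit⟩

/-- The negation of a formal formula. -/
def neg (φ : EFm D obj Γ) : EFm D obj Γ := ⟨φ.dom, φ.predᶜ, φ.arg⟩

/-- A binary connective applied to formal formulas. -/
def binary (b : ∀ X : C, D.Pred X → D.Pred X → D.Pred X) (φ ψ : EFm D obj Γ) : EFm D obj Γ :=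
  ⟨φ.dom ⊗ ψ.dom, b _ (D.reindex (fst _ _) φ.pred) (D.reindex (snd _ _) ψ.pred),
    .pair φ.arg ψ.arg⟩

theorem val_neg (φ : EFm D obj Γ) : φ.neg.val = φ.valᶜ :=
  D.reindex_compl _ _

theorem val_binary (b : ∀ X : C, D.Pred X → D.Pred X → D.Pred X)
    (hb : ∀ (X Y : C) (f : X ⟶ Y) (p q : D.Pred Y),
      D.reindex f (b Y p q) = b X (D.reindex f p) (D.reindex f q))
    (φ ψ : EFm D obj Γ) : (binary b φ ψ).val = b _ φ.val ψ.val := by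
  simp only [val, binary, hb, ← BooleanDoctrine.reindex_comp, ETm.val, lift_fst, lift_snd]

/-- The abstraction of the last variable in the argument of a formal formula. -/
def abs (ψ : EFm D obj (A :: Γ)) : Abstraction D obj Γ (obj A) ψ.dom :=
  Abstraction.ofSum ψ.arg.abs

/-- The predicate of the abstraction of a formal formula. -/
def absPred (ψ : EFm D obj (A :: Γ)) : D.Pred (ψ.abs.dom ⊗ obj A) :=
  D.reindex ψ.abs.hom ψ.pred

theorem val_absPred (ψ : EFm D obj (A :: Γ)) :
    D.reindex (ψ.abs.arg.val ▷ obj A) ψ.absPred = ψ.val := by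
  rw [absPred, ← BooleanDoctrine.reindex_comp]
  exact congrArg (D.reindex · ψ.pred) (ETm.val_abs ψ.arg)

/-- A quantifier applied to a formal formula. -/
def quant (Q : ∀ X Y : C, D.Pred (X ⊗ Y) → D.Pred X) (ψ : EFm D obj (A :: Γ)) : EFm D obj Γ :=
  ⟨ψ.abs.dom, Q _ _ ψ.absPred, ψ.abs.arg⟩

theorem val_quant (Q : ∀ X Y : C, D.Pred (X ⊗ Y) → D.Pred X)
    (hQ : ∀ (X Y Z : C) (f : Z ⟶ X) (p : D.Pred (X ⊗ Y)),
      D.reindex f (Q X Y p) = Q Z Y (D.reindex (f ▷ Y) p))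
    (ψ : EFm D obj (A :: Γ)) : (ψ.quant Q).val = Q _ _ ψ.val := by
  rw [val, quant, hQ, val_absPred]

/-- The formal term `ε_ψ`, for a choice `e` of morphisms. -/
def eps (e : ∀ X Y : C, D.Pred (X ⊗ Y) → (X ⟶ Y)) (ψ : EFm D obj (A :: Γ)) :
    ETm D obj Γ (obj A) :=
  .app (e _ _ ψ.absPred) ψ.abs.arg

theorem isEpsilonMorphism_val_eps (e : ∀ X Y : C, D.Pred (X ⊗ Y) → (X ⟶ Y))
    (he : ∀ (X Y : C) (p : D.Pred (X ⊗ Y)), D.IsEpsilonMorphism p (e X Y p))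
    (ψ : EFm D obj (A :: Γ)) : D.IsEpsilonMorphism ψ.val (ψ.eps e).val := by
  rw [← val_absPred]
  exact (he _ _ ψ.absPred).reindex _

theorem abs_subst (σ : ∀ B : T, Var Γ B → ETm D obj Δ (obj B)) (ψ : EFm D obj (A :: Γ)) :
    (ψ.subst (ETm.liftSub σ A)).abs = ψ.abs.subst σ := by
  rw [abs, abs, ← Abstraction.ofSum_substSum, ← ETm.abs_subst]
  rfl

theorem quant_subst (Q : ∀ X Y : C, D.Pred (X ⊗ Y) → D.Pred X)
    (σ : ∀ B : T, Var Γ B → ETm D obj Δ (obj B)) (ψ : EFm D obj (A :: Γ)) :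
    (ψ.subst (ETm.liftSub σ A)).quant Q = (ψ.quant Q).subst σ :=
  congrArg (fun a : Abstraction D obj Δ (obj A) ψ.dom =>
    (⟨a.dom, Q _ _ (D.reindex a.hom ψ.pred), a.arg⟩ : EFm D obj Δ)) (abs_subst σ ψ)

theorem eps_subst (e : ∀ X Y : C, D.Pred (X ⊗ Y) → (X ⟶ Y))
    (σ : ∀ B : T, Var Γ B → ETm D obj Δ (obj B)) (ψ : EFm D obj (A :: Γ)) :
    (ψ.subst (ETm.liftSub σ A)).eps e = (ψ.eps e).subst σ :=
  congrArg (fun a : Abstraction D obj Δ (obj A) ψ.dom =>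
    (.app (e _ _ (D.reindex a.hom ψ.pred)) a.arg : ETm D obj Δ (obj A))) (abs_subst σ ψ)

end EFm

/-! ### Translation of the Epsilon calculus into formal terms and formulas -/

section Translation

variable (M : Assignment S D) (e : ∀ X Y : C, D.Pred (X ⊗ Y) → (X ⟶ Y))

mutual

/-- The translation of terms. -/
def Tm.formal {Γ : S.Ctx} {A : S.Ty} : Tm S Γ A → ETm D M.obj Γ (M.obj A)
  | .var x => .var x
  | .fn f args => .app (M.fn f) (ETm.tuple _ (fun B x => (args B x).formal))
  | .eps ψ => ψ.formal.eps e

/-- The translation of formulas. -/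
def Fm.formal {Γ : S.Ctx} : Fm S Γ → EFm D M.obj Γ
  | .rel r args => ⟨_, M.rel r, ETm.tuple _ (fun B x => (args B x).formal)⟩
  | .top => .const ⊤
  | .bot => .const ⊥
  | .and φ ψ => .binary (fun _ p q => p ⊓ q) φ.formal ψ.formal
  | .or φ ψ => .binary (fun _ p q => p ⊔ q) φ.formal ψ.formal
  | .imp φ ψ => .binary (fun _ p q => p ⇨ q) φ.formal ψ.formal
  | .neg φ => φ.formal.neg
  | .all ψ => ψ.formal.quant D.pi
  | .ex ψ => ψ.formal.quant D.sigma

end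

theorem liftSub_var {Γ Δ : S.Ctx} (ρ : Ren Γ Δ) (A : S.Ty) :
    ETm.liftSub (D := D) (obj := M.obj) (fun B x => .var (ρ B x)) A =
      fun B x => .var (ρ.lift A B x) := by
  funext B x
  cases x <;> rfl

mutual

theorem Tm.formal_rename {Γ Δ : S.Ctx} {A : S.Ty} (ρ : Ren Γ Δ) : ∀ t : Tm S Γ A,
    (t.rename ρ).formal M e = (t.formal M e).subst (fun B x => .var (ρ B x))
  | .var x => rfl
  | .fn f args => by
      simp only [Tm.rename, Tm.formal, ETm.subst, ETm.subst_tuple]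
      congr 2
      funext B x
      exact (args B x).formal_rename ρ
  | .eps ψ => by
      rw [Tm.rename, Tm.formal, Tm.formal, ψ.formal_rename, ← EFm.eps_subst, liftSub_var]

theorem Fm.formal_rename {Γ Δ : S.Ctx} (ρ : Ren Γ Δ) : ∀ φ : Fm S Γ,
    (φ.rename ρ).formal M e = (φ.formal M e).subst (fun B x => .var (ρ B x))
  | .rel r args => by
      simp only [Fm.rename, Fm.formal, EFm.subst, ETm.subst_tuple]
      congr 2
      funext B x
      exact (args B x).formal_rename ρ
  | .top => rfl
  | .bot => rfl
  | .and φ ψ => by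
      rw [Fm.rename, Fm.formal, Fm.formal, φ.formal_rename, ψ.formal_rename]; rfl
  | .or φ ψ => by
      rw [Fm.rename, Fm.formal, Fm.formal, φ.formal_rename, ψ.formal_rename]; rfl
  | .imp φ ψ => by
      rw [Fm.rename, Fm.formal, Fm.formal, φ.formal_rename, ψ.formal_rename]; rfl
  | .neg φ => by
      rw [Fm.rename, Fm.formal, Fm.formal, φ.formal_rename]; rfl
  | .all ψ => by
      rw [Fm.rename, Fm.formal, Fm.formal, ψ.formal_rename, ← EFm.quant_subst, liftSub_var]
  | .ex ψ => by
      rw [Fm.rename, Fm.formal, Fm.formal, ψ.formal_rename, ← EFm.quant_subst, liftSub_var]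

end

theorem liftSub_formal {Γ Δ : S.Ctx} (σ : Sub S Γ Δ) (A : S.Ty) :
    ETm.liftSub (fun B x => (σ B x).formal M e) A =
      fun B x => (σ.lift A B x).formal M e := by
  funext B x
  cases x with
  | zero => rfl
  | succ x => exact ((σ _ x).formal_rename M e _).symm

mutual

theorem Tm.formal_subst {Γ Δ : S.Ctx} {A : S.Ty} (σ : Sub S Γ Δ) : ∀ t : Tm S Γ A,
    (t.subst σ).formal M e = (t.formal M e).subst (fun B x => (σ B x).formal M e)
  | .var x => rfl
  | .fn f args => by
      simp only [Tm.subst, Tm.formal, ETm.subst, ETm.subst_tuple]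
      congr 2
      funext B x
      exact (args B x).formal_subst σ
  | .eps ψ => by
      rw [Tm.subst, Tm.formal, Tm.formal, ψ.formal_subst, ← EFm.eps_subst, liftSub_formal]

theorem Fm.formal_subst {Γ Δ : S.Ctx} (σ : Sub S Γ Δ) : ∀ φ : Fm S Γ,
    (φ.subst σ).formal M e = (φ.formal M e).subst (fun B x => (σ B x).formal M e)
  | .rel r args => by
      simp only [Fm.subst, Fm.formal, EFm.subst, ETm.subst_tuple]
      congr 2
      funext B x
      exact (args B x).formal_subst σ
  | .top => rfl
  | .bot => rfl
  | .and φ ψ => by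
      rw [Fm.subst, Fm.formal, Fm.formal, φ.formal_subst, ψ.formal_subst]; rfl
  | .or φ ψ => by
      rw [Fm.subst, Fm.formal, Fm.formal, φ.formal_subst, ψ.formal_subst]; rfl
  | .imp φ ψ => by
      rw [Fm.subst, Fm.formal, Fm.formal, φ.formal_subst, ψ.formal_subst]; rfl
  | .neg φ => by
      rw [Fm.subst, Fm.formal, Fm.formal, φ.formal_subst]; rfl
  | .all ψ => by
      rw [Fm.subst, Fm.formal, Fm.formal, ψ.formal_subst, ← EFm.quant_subst, liftSub_formal]
  | .ex ψ => by
      rw [Fm.subst, Fm.formal, Fm.formal, ψ.formal_subst, ← EFm.quant_subst, liftSub_formal]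

end

/-- The interpretation by the values of the translations, for a choice `e` of epsilon
morphisms. -/
def interpretation
    (he : ∀ (X Y : C) (p : D.Pred (X ⊗ Y)), D.IsEpsilonMorphism p (e X Y p)) :
    Interpretation M where
  tm t := (t.formal M e).val
  fm φ := (φ.formal M e).val
  tm_var _ := rfl
  tm_fn f args := by rw [Tm.formal, ETm.val, ETm.val_tuple]
  tm_eps ψ := EFm.isEpsilonMorphism_val_eps e he (ψ.formal M e)
  fm_rel r args := by rw [Fm.formal, EFm.val, ETm.val_tuple]
  fm_top := map_top (D.P.map _).hom
  fm_bot := map_bot (D.P.map _).hom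
  fm_and φ ψ := EFm.val_binary _ (fun _ _ f p q => map_inf (D.P.map f.op).hom p q) _ _
  fm_or φ ψ := EFm.val_binary _ (fun _ _ f p q => map_sup (D.P.map f.op).hom p q) _ _
  fm_imp φ ψ := EFm.val_binary _ (fun _ _ f p q => map_himp (D.P.map f.op).hom p q) _ _
  fm_neg φ := EFm.val_neg _
  fm_all ψ := EFm.val_quant _ (fun _ _ _ f p => D.reindex_pi f p) _
  fm_ex ψ := EFm.val_quant _ (fun _ _ _ f p => D.reindex_sigma f p) _

end Translation

/-! ### Soundness -/

namespace Interpretation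

variable {M : Assignment S D} (I : Interpretation M)

/-- The meet of the values of a list of formulas. -/
def hyps {Γ : S.Ctx} (Φ : List (Fm S Γ)) : D.Pred (ctxObj M.obj Γ) :=
  (Φ.map I.fm).foldr (· ⊓ ·) ⊤

theorem hyps_cons {Γ : S.Ctx} (φ : Fm S Γ) (Φ : List (Fm S Γ)) :
    I.hyps (φ :: Φ) = I.fm φ ⊓ I.hyps Φ := rfl

theorem le_hyps_iff {Γ : S.Ctx} (p : D.Pred (ctxObj M.obj Γ)) (Φ : List (Fm S Γ)) :
    p ≤ I.hyps Φ ↔ ∀ φ ∈ Φ, p ≤ I.fm φ := by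
  induction Φ with
  | nil => simp [hyps]
  | cons φ Φ ih => rw [hyps_cons, le_inf_iff, ih]; simp

theorem hyps_le {Γ : S.Ctx} {φ : Fm S Γ} {Φ : List (Fm S Γ)} (h : φ ∈ Φ) :
    I.hyps Φ ≤ I.fm φ :=
  (I.le_hyps_iff _ Φ).1 le_rfl φ h

theorem hyps_map {Γ Δ : S.Ctx} (g : Fm S Γ → Fm S Δ) (f : ctxObj M.obj Δ ⟶ ctxObj M.obj Γ)
    (hg : ∀ φ, I.fm (g φ) = D.reindex f (I.fm φ)) (Φ : List (Fm S Γ)) :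
    I.hyps (Φ.map g) = D.reindex f (I.hyps Φ) := by
  induction Φ with
  | nil => exact (map_top (D.P.map f.op).hom).symm
  | cons φ Φ ih =>
    rw [List.map_cons, hyps_cons, hyps_cons, ih, hg]
    exact (map_inf (D.P.map f.op).hom _ _).symm

theorem sub_single {Γ : S.Ctx} {A : S.Ty} (t : Tm S Γ A) :
    I.sub (Sub.single t) = lift (𝟙 _) (I.tm t) := by
  have h := tuple_comp_varHom M.obj (𝟙 (ctxObj M.obj Γ))
  simp only [Category.id_comp] at h
  simp only [sub, tuple, Sub.single, tm_var, h]

theorem valid_of_derivable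
    (hfst : ∀ {Γ : S.Ctx} (A : S.Ty) (φ : Fm S Γ),
      I.fm (φ.weaken A) = D.reindex (fst (ctxObj M.obj Γ) (M.obj A)) (I.fm φ))
    (htm : ∀ {Γ Δ : S.Ctx} {A : S.Ty} (t : Tm S Γ A) (σ : Sub S Γ Δ),
      I.tm (t.subst σ) = I.sub σ ≫ I.tm t)
    (hfm : ∀ {Γ Δ : S.Ctx} (φ : Fm S Γ) (σ : Sub S Γ Δ),
      I.fm (φ.subst σ) = D.reindex (I.sub σ) (I.fm φ))
    {T : Set (Judgment S)} (hT : ∀ J ∈ T, I.Valid J) {J : Judgment S} (h : Derivable T J) :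
    I.Valid J := by
  have hinst : ∀ {Γ : S.Ctx} {A : S.Ty} (ψ : Fm S (A :: Γ)) (t : Tm S Γ A),
      I.fm (ψ.inst t) = D.reindex (lift (𝟙 _) (I.tm t)) (I.fm ψ) := fun ψ t => by
    rw [Fm.inst, hfm, sub_single]
  have hweak : ∀ {Γ : S.Ctx} {A : S.Ty} (p : D.Pred (ctxObj M.obj Γ)) (t : Tm S Γ A),
      D.reindex (lift (𝟙 _) (I.tm t)) (D.reindex (fst (ctxObj M.obj Γ) (M.obj A)) p) = p :=
    fun p t => by rw [← BooleanDoctrine.reindex_comp, lift_fst, BooleanDoctrine.reindex_id]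
  have hsub : ∀ {Γ Δ : S.Ctx} {σ σ' : Sub S Γ Δ},
      (∀ (B : S.Ty) (x : Var Γ B), I.tm (σ B x) = I.tm (σ' B x)) → I.sub σ = I.sub σ' :=
    fun h => congrArg (tuple M.obj _) (funext fun B => funext fun x => h B x)
  induction h with
  | of_mem h => exact hT _ h
  | eq_refl t => exact rfl
  | eq_symm _ h => exact Eq.symm h
  | eq_trans _ _ h h' => exact Eq.trans h h'
  | @eq_subst Γ Δ A t t' σ σ' _ _ ht hσ =>
    have ht : I.tm t = I.tm t' := ht
    change I.tm _ = I.tm _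
    rw [htm, htm, ht, hsub hσ]
  | eq_fm φ _ hσ =>
    change I.fm _ ⊓ ⊤ ≤ I.fm _
    rw [hfm, hfm, hsub hσ]
    exact inf_le_left
  | hyp h => exact I.hyps_le h
  | weaken hs _ h => exact le_trans ((I.le_hyps_iff _ _).2 fun φ hφ => I.hyps_le (hs hφ)) h
  | cut _ _ h h' => exact le_trans (le_inf h le_rfl) h'
  | @seq_subst Γ Δ Φ φ σ _ h =>
    change I.hyps _ ≤ _
    rw [I.hyps_map _ _ (fun φ => hfm φ σ), hfm]
    exact D.reindex_mono _ h
  | top_intro => exact le_of_le_of_eq le_top I.fm_top.symm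
  | bot_elim _ h => exact le_trans (le_of_le_of_eq h I.fm_bot) bot_le
  | and_intro _ _ h h' => exact le_of_le_of_eq (le_inf h h') (I.fm_and _ _).symm
  | and_left _ h => exact le_trans (le_of_le_of_eq h (I.fm_and _ _)) inf_le_left
  | and_right _ h => exact le_trans (le_of_le_of_eq h (I.fm_and _ _)) inf_le_right
  | or_inl _ h => exact le_of_le_of_eq (le_trans h le_sup_left) (I.fm_or _ _).symm
  | or_inr _ h => exact le_of_le_of_eq (le_trans h le_sup_right) (I.fm_or _ _).symm
  | @or_elim Γ Φ φ ψ χ _ _ _ h h₁ h₂ =>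
    have h : I.hyps Φ ≤ _ := le_of_le_of_eq h (I.fm_or _ _)
    have h₁ : I.fm φ ⊓ I.hyps Φ ≤ I.fm χ := h₁
    have h₂ : I.fm ψ ⊓ I.hyps Φ ≤ I.fm χ := h₂
    exact le_trans (le_inf h le_rfl) (by rw [inf_sup_right]; exact sup_le h₁ h₂)
  | @imp_intro Γ Φ φ ψ _ h =>
    have h : I.fm φ ⊓ I.hyps Φ ≤ I.fm ψ := h
    exact le_of_le_of_eq (le_himp_iff'.2 h) (I.fm_imp _ _).symm
  | @imp_elim Γ Φ φ ψ _ _ h h' =>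
    have h : I.hyps Φ ≤ I.fm φ ⇨ I.fm ψ := le_of_le_of_eq h (I.fm_imp _ _)
    exact le_trans (le_inf h h') himp_inf_le
  | @neg_intro Γ Φ φ _ h =>
    have h : I.fm φ ⊓ I.hyps Φ ≤ ⊥ := le_of_le_of_eq h I.fm_bot
    exact le_of_le_of_eq (le_compl_iff_disjoint_left.2 (disjoint_iff_inf_le.2 h))
      (I.fm_neg _).symm
  | @neg_elim Γ Φ φ _ _ h h' =>
    have h : I.hyps Φ ≤ (I.fm φ)ᶜ := le_of_le_of_eq h (I.fm_neg _)
    exact le_trans (le_trans (le_inf h h') (compl_inf_self _).le) bot_le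
  | em φ =>
    refine le_of_le_of_eq le_top ?_
    rw [fm_or, fm_neg, sup_compl_eq_top]
  | @all_intro Γ A Φ ψ _ h =>
    have h : I.hyps _ ≤ _ := h
    rw [I.hyps_map _ _ (hfst A)] at h
    exact le_of_le_of_eq ((D.pi_adj _ _ _ _).1 h) (I.fm_all _).symm
  | @all_elim Γ A Φ ψ t _ h =>
    have h : I.hyps Φ ≤ _ := le_of_le_of_eq h (I.fm_all _)
    change I.hyps Φ ≤ _
    rw [hinst, ← hweak (I.hyps Φ) t]
    exact D.reindex_mono _ ((D.pi_adj _ _ _ _).2 h)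
  | @ex_intro Γ A Φ ψ t _ h =>
    have h : I.hyps Φ ≤ _ := le_of_le_of_eq h (hinst _ _)
    change I.hyps Φ ≤ _
    rw [fm_ex, ← hweak (D.sigma _ _ _) t]
    exact h.trans (D.reindex_mono _ ((D.sigma_adj _ _).le_u_l _))
  | @ex_elim Γ A Φ ψ χ _ _ h h' =>
    have h : I.hyps Φ ≤ _ := le_of_le_of_eq h (I.fm_ex _)
    have h' : I.fm ψ ⊓ I.hyps _ ≤ _ := h'
    rw [I.hyps_map _ _ (hfst A), hfst, ← le_himp_iff] at h'
    have h₁ : D.sigma _ _ (I.fm ψ) ≤ I.hyps Φ ⇨ I.fm χ :=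
      (D.sigma_adj _ _ _ _).2
        (h'.trans (map_himp (D.P.map (fst (ctxObj M.obj Γ) (M.obj A)).op).hom _ _).ge)
    exact le_trans (le_inf (h.trans h₁) le_rfl) himp_inf_le
  | eps_intro ψ =>
    change I.fm _ ⊓ ⊤ ≤ I.fm _
    rw [fm_ex, hinst]
    exact inf_le_left.trans (I.tm_eps ψ)

end Interpretation

end

end EpsilonCalculus

theorem mainTheorem3 (S : EpsilonCalculus.Signature.{u₁, u₂, u₃})
    {C : Type u} [Category.{v} C] [CartesianMonoidalCategory C]
    (D : EpsilonCalculus.BooleanDoctrine.{v, u, w} C) (hD : D.IsEpsilonDoctrine)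
    (M : EpsilonCalculus.Assignment S D) :
    ∃ I : EpsilonCalculus.Interpretation M,
      (∀ {Γ Δ : S.Ctx} {A : S.Ty} (t : EpsilonCalculus.Tm S Γ A) (σ : EpsilonCalculus.Sub S Γ Δ),
        I.tm (t.subst σ) = I.sub σ ≫ I.tm t) ∧
      (∀ {Γ Δ : S.Ctx} (φ : EpsilonCalculus.Fm S Γ) (σ : EpsilonCalculus.Sub S Γ Δ),
        I.fm (φ.subst σ) = D.reindex (I.sub σ) (I.fm φ)) ∧
      (∀ (T : Set (EpsilonCalculus.Judgment S)), (∀ J ∈ T, I.Valid J) →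
        ∀ J : EpsilonCalculus.Judgment S, EpsilonCalculus.Derivable T J → I.Valid J) := by
  choose e he using hD
  have htm : ∀ {Γ Δ : S.Ctx} {A : S.Ty} (t : EpsilonCalculus.Tm S Γ A)
      (σ : EpsilonCalculus.Sub S Γ Δ),
      (EpsilonCalculus.interpretation M e he).tm (t.subst σ) =
        (EpsilonCalculus.interpretation M e he).sub σ ≫
          (EpsilonCalculus.interpretation M e he).tm t := fun t σ =>
    (congrArg EpsilonCalculus.ETm.val (t.formal_subst M e σ)).trans
      (EpsilonCalculus.ETm.val_subst _ _)
  have hfm : ∀ {Γ Δ : S.Ctx} (φ : EpsilonCalculus.Fm S Γ) (σ : EpsilonCalculus.Sub S Γ Δ),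
      (EpsilonCalculus.interpretation M e he).fm (φ.subst σ) =
        D.reindex ((EpsilonCalculus.interpretation M e he).sub σ)
          ((EpsilonCalculus.interpretation M e he).fm φ) := fun φ σ =>
    (congrArg EpsilonCalculus.EFm.val (φ.formal_subst M e σ)).trans
      (EpsilonCalculus.EFm.val_subst _ _)
  refine ⟨EpsilonCalculus.interpretation M e he, htm, hfm, fun T hT J hJ =>
    EpsilonCalculus.Interpretation.valid_of_derivable _ (fun A φ => ?_) htm hfm hT hJ⟩
  refine (congrArg EpsilonCalculus.EFm.val (φ.formal_rename M e _)).trans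
    ((EpsilonCalculus.EFm.val_subst _ _).trans ?_)
  exact congrArg (D.reindex · _) (EpsilonCalculus.tuple_comp_varHom M.obj (fst _ _))
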